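/- All graphs are finite and simple. In a burning process on a connected graph $G$, all vertices are initially unburned. In each round $r\ge 1$ one chooses a vertex $x_r$ that is unburned at the start of the round (the source of round $r$), and burns $x_r$ together with all neighbors of the vertices that were burned before round $r$; burned vertices remain burned. The process terminates when all vertices are burned; if it terminates in $k$ rounds, then $(x_1,\dots,x_k)$ is a burning sequence for $G$ of length $k$. The burning number $b(G)$ is the minimum length of a burning sequence for $G$. A full binary tree is a rooted tree in which every vertex has either $0$ or $2$ children. **Theorem.** Let $T$ be a full binary tree of order $n$ (that is, with $n$ vertices). Then $$b(T)\le \left\lceil \sqrt{n}\,\right\rceil.$$ -/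

import Mathlib

namespace GraphBurning

variable {V : Type*}

/-- The set of vertices that are burned at the end of round `r`, when `x 0, …, x (k - 1)` are the
sources of the rounds `1, …, k` (so the source of round `r + 1` is `x r`). Nothing is burned at the
start; in each round the source of that round burns, together with all the neighbors of the
vertices that were burned before that round; a burned vertex remains burned. -/
def burned (G : SimpleGraph V) {k : ℕ} (x : Fin k → V) : ℕ → Set V
  | 0 => ∅
  | r + 1 => burned G x r ∪ {v | ∃ u ∈ burned G x r, G.Adj u v} ∪ {v | ∃ h : r < k, v = x ⟨r, h⟩}

/-- `x` is a burning sequence for `G` of length `k`: each source is unburned when it is chosen, and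
after `k` rounds all the vertices are burned. As the last source is unburned before round `k`, the
process does not terminate before round `k`. -/
def IsBurningSequence (G : SimpleGraph V) {k : ℕ} (x : Fin k → V) : Prop :=
  (∀ i : Fin k, x i ∉ burned G x i) ∧ burned G x k = Set.univ

/-- The burning number: the minimum length of a burning sequence. For finite graphs the set of
lengths is nonempty, see `exists_isBurningSequence`. -/
noncomputable def burningNumber (G : SimpleGraph V) : ℕ :=
  sInf {k : ℕ | ∃ x : Fin k → V, IsBurningSequence G x}

/-- The children of `v` in the tree `T` rooted at `root`: the neighbors of `v` that are one step
further away from the root. -/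
def children (T : SimpleGraph V) (root v : V) : Set V :=
  {w | T.Adj v w ∧ T.dist root w = T.dist root v + 1}

/-- A full binary tree: a tree with a root, with respect to which every vertex has either no
children or exactly two children. -/
def IsFullBinaryTree (T : SimpleGraph V) : Prop :=
  T.IsTree ∧ ∃ root : V, ∀ v : V, (children T root v).encard = 0 ∨ (children T root v).encard = 2

theorem burned_subset_succ (G : SimpleGraph V) {k : ℕ} (x : Fin k → V) (r : ℕ) :
    burned G x r ⊆ burned G x (r + 1) :=
  fun _ hv => Or.inl (Or.inl hv)

theorem burned_snoc (G : SimpleGraph V) {k : ℕ} (x : Fin k → V) (y : V) (r : ℕ) (hr : r ≤ k) :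
    burned G (Fin.snoc x y : Fin (k + 1) → V) r = burned G x r := by
  induction r with
  | zero => rfl
  | succ r ih =>
    have hrk : r < k := hr
    have hsn : (Fin.snoc x y : Fin (k + 1) → V) ⟨r, by omega⟩ = x ⟨r, hrk⟩ :=
      Fin.snoc_castSucc (α := fun _ => V) y x ⟨r, hrk⟩
    have hs : {v | ∃ h : r < k + 1, v = (Fin.snoc x y : Fin (k + 1) → V) ⟨r, h⟩} =
        {v | ∃ h : r < k, v = x ⟨r, h⟩} := by
      ext v
      constructor
      · rintro ⟨_, h⟩
        exact ⟨hrk, h.trans hsn⟩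
      · rintro ⟨_, h⟩
        exact ⟨by omega, h.trans hsn.symm⟩
    simp only [burned, ih (by omega), hs]

/-- Every finite graph has a burning sequence. -/
theorem exists_isBurningSequence [Finite V] (G : SimpleGraph V) :
    {k : ℕ | ∃ x : Fin k → V, IsBurningSequence G x}.Nonempty := by
  by_contra hne
  have key : ∀ k : ℕ, ∃ x : Fin k → V, ∀ i : Fin k, x i ∉ burned G x i := by
    intro k
    induction k with
    | zero => exact ⟨Fin.elim0, fun i => i.elim0⟩
    | succ k ih =>
      obtain ⟨x, hx⟩ := ih
      have hu : burned G x k ≠ Set.univ := fun h => hne ⟨k, x, hx, h⟩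
      obtain ⟨y, hy⟩ := (Set.ne_univ_iff_exists_notMem _).1 hu
      refine ⟨Fin.snoc x y, fun i => ?_⟩
      rw [burned_snoc G x y i (Nat.lt_succ_iff.1 i.2)]
      refine Fin.lastCases ?_ (fun j => ?_) i
      · simpa using hy
      · simpa using hx j
  obtain ⟨x, hx⟩ := key (Nat.card V + 1)
  have hmono : Monotone (burned G x) := monotone_nat_of_le_succ (burned_subset_succ G x)
  have hinj : Function.Injective x := by
    have hlt : ∀ i j : Fin (Nat.card V + 1), i < j → x i ≠ x j := by
      intro i j hij he
      apply hx j
      rw [← he]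
      exact hmono (Nat.succ_le_of_lt hij) (Or.inr ⟨i.2, rfl⟩)
    intro i j he
    rcases lt_trichotomy i j with h | h | h
    · exact absurd he (hlt i j h)
    · exact h
    · exact absurd he.symm (hlt j i h)
  have hc := Nat.card_le_card_of_injective x hinj
  simp at hc

end GraphBurning

/-! It suffices to cover the tree by balls of radii 0, …, r, where r + 1 = ⌈√n⌉: the center of the
ball of radius i becomes the source of round r + 1 - i, unless it has burned before.

Balls are cut off greedily, largest radius first, from an ancestor-closed set `S`. The weight of `S`
is its number of vertices plus its number of `broken` vertices, those with one remaining child and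
height below a threshold that drops with the radius. A full binary tree has weight n. By
`exists_remove`, a ball of radius r lowers the weight by 2r + 1 = (r + 1)² - r², which drives the
induction in `exists_cover`.

The ball is centered at a vertex v of height r. Its subtree weighs at least 2r + 1
(`two_mul_add_one_le_card_below`), since each vertex with a child on a longest path has a second
child or is broken. The cut may break ancestors of v; these are too tall to count, or paid for by
further vertices removed within the ball. -/

/-- A rooted tree, given by the parent and the depth of each vertex; the root is its own parent. -/
structure ParentTree (V : Type*) where
  /-- The root. -/
  root : V
  /-- The parent of a vertex. -/
  par : V → V
  /-- The distance of a vertex from the root. -/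
  depth : V → ℕ
  depth_root : depth root = 0
  eq_root : ∀ v, depth v = 0 → v = root
  depth_par : ∀ v, depth (par v) = depth v - 1

/-! ### Ancestors in a rooted tree. -/

namespace ParentTree

variable {V : Type*} (P : ParentTree V)

/-- `v` is an ancestor of `x`, or `x` itself. -/
def Anc (v x : V) : Prop := P.par^[P.depth x - P.depth v] x = v

theorem depth_iterate (k : ℕ) (x : V) : P.depth (P.par^[k] x) = P.depth x - k := by
  induction k with
  | zero => simp
  | succ k ih => rw [Function.iterate_succ_apply', P.depth_par, ih]; omega

variable {P}

theorem Anc.depth_le {v x : V} (h : P.Anc v x) : P.depth v ≤ P.depth x := by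
  have := P.depth_iterate (P.depth x - P.depth v) x
  rw [h] at this
  omega

theorem Anc.refl (x : V) : P.Anc x x := by simp [Anc]

theorem Anc.trans {a b c : V} (h : P.Anc a b) (h' : P.Anc b c) : P.Anc a c := by
  have h1 := h.depth_le
  have h2 := h'.depth_le
  unfold Anc at *
  rw [show P.depth c - P.depth a = (P.depth b - P.depth a) + (P.depth c - P.depth b) by omega,
    Function.iterate_add_apply, h', h]

theorem Anc.linear {a b x : V} (h : P.Anc a x) (h' : P.Anc b x) (hd : P.depth a ≤ P.depth b) :
    P.Anc a b := by
  have h2 := h'.depth_le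
  unfold Anc at *
  rw [show P.depth x - P.depth a = (P.depth b - P.depth a) + (P.depth x - P.depth b) by omega,
    Function.iterate_add_apply, h'] at h
  exact h

theorem Anc.eq_of_depth_le {a b : V} (h : P.Anc a b) (hd : P.depth b ≤ P.depth a) : a = b := by
  unfold Anc at h
  rw [Nat.sub_eq_zero_of_le hd] at h
  exact h.symm

theorem Anc.eq_of_depth_eq {a b x : V} (h : P.Anc a x) (h' : P.Anc b x)
    (hd : P.depth a = P.depth b) : a = b :=
  (h.linear h' hd.le).eq_of_depth_le hd.ge

theorem Anc.depth_lt {a b : V} (h : P.Anc a b) (hne : a ≠ b) : P.depth a < P.depth b := by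
  by_contra hd
  exact hne (h.eq_of_depth_le (not_lt.1 hd))

theorem anc_iterate {k : ℕ} {x : V} (hk : k ≤ P.depth x) : P.Anc (P.par^[k] x) x := by
  unfold Anc
  rw [P.depth_iterate, Nat.sub_sub_self hk]

theorem anc_root (x : V) : P.Anc P.root x := by
  have h := anc_iterate (P := P) (le_refl (P.depth x))
  rwa [P.eq_root (P.par^[P.depth x] x) (by rw [P.depth_iterate, Nat.sub_self])] at h

theorem anc_of_depth_eq {b p : V} (hp : P.par b = p) (h : P.depth b = P.depth p + 1) :
    P.Anc p b := by
  unfold Anc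
  rw [h, Nat.add_sub_cancel_left]
  exact hp

/-- The child of `v` on the way to its proper descendant `x`. -/
theorem Anc.exists_child {v x : V} (h : P.Anc v x) (hne : v ≠ x) :
    ∃ c, P.par c = v ∧ P.depth c = P.depth v + 1 ∧ P.Anc c x := by
  have hd := h.depth_lt hne
  refine ⟨P.par^[P.depth x - P.depth v - 1] x, ?_, ?_, anc_iterate (by omega)⟩
  · rw [← Function.iterate_succ_apply' P.par,
      show (P.depth x - P.depth v - 1).succ = P.depth x - P.depth v by omega]
    exact h
  · rw [P.depth_iterate]
    omega

theorem Anc.anc_par {v x : V} (h : P.Anc v x) (hne : v ≠ x) : P.Anc v (P.par x) := by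
  have hd := h.depth_lt hne
  have h1 : P.Anc (P.par x) x := anc_of_depth_eq rfl (by rw [P.depth_par]; omega)
  exact h.linear h1 (by rw [P.depth_par]; omega)

/-! ### Broken vertices and the weight of an ancestor-closed set. -/

variable (P) in
/-- The path between `v` and `x` through some common ancestor has length at most `r`. -/
def Near (r : ℕ) (v x : V) : Prop :=
  ∃ a, P.Anc a v ∧ P.Anc a x ∧ P.depth v + P.depth x ≤ r + 2 * P.depth a

variable (P) in
/-- The part of the tree below `v` that lies in `S` has height at least `k`. -/
def Tall (S : Finset V) (k : ℕ) (v : V) : Prop :=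
  ∃ x ∈ S, P.Anc v x ∧ P.depth v + k ≤ P.depth x

variable (P) in
/-- `S` is closed under taking ancestors. -/
def Closed (S : Finset V) : Prop := ∀ x ∈ S, ∀ v, P.Anc v x → v ∈ S

open Classical in
variable (P) in
/-- The children of `v` in `S`. -/
noncomputable def childrenIn (S : Finset V) (v : V) : Finset V :=
  S.filter fun c => P.par c = v ∧ P.depth c = P.depth v + 1

open Classical in
variable (P) in
/-- The vertices of `S` with exactly one child in `S`, the height below them being less
than `m`. -/
noncomputable def broken (m : ℕ) (S : Finset V) : Finset V :=
  S.filter fun v => (P.childrenIn S v).card = 1 ∧ ¬ P.Tall S m v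

open Classical in
variable (P) in
/-- The vertices of `S` below `v`, including `v`. -/
noncomputable def below (S : Finset V) (v : V) : Finset V := S.filter fun x => P.Anc v x

theorem mem_childrenIn {S : Finset V} {v c : V} :
    c ∈ P.childrenIn S v ↔ c ∈ S ∧ P.par c = v ∧ P.depth c = P.depth v + 1 := by
  simp [childrenIn]

theorem mem_broken {S : Finset V} {m : ℕ} {v : V} :
    v ∈ P.broken m S ↔ v ∈ S ∧ (P.childrenIn S v).card = 1 ∧ ¬ P.Tall S m v := by
  simp [broken]

theorem mem_below {S : Finset V} {v x : V} : x ∈ P.below S v ↔ x ∈ S ∧ P.Anc v x := by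
  simp [below]

open Classical in
/-- Counting each vertex with a single child twice, a subtree of height at least `k` has at least
`2 * k + 1` vertices. -/
theorem two_mul_add_one_le_card_below {S : Finset V} (hS : P.Closed S) {m : ℕ} (k : ℕ) (v : V)
    (hk : P.Tall S k v) (hm : ¬ P.Tall S m v) :
    2 * k + 1 ≤ (P.below S v).card + (P.broken m S ∩ P.below S v).card := by
  induction k generalizing v with
  | zero =>
    obtain ⟨x, hx, hvx, -⟩ := hk
    have : 0 < (P.below S v).card :=
      Finset.card_pos.2 ⟨x, mem_below.2 ⟨hx, hvx⟩⟩
    omega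
  | succ k ih =>
    obtain ⟨x, hx, hvx, hd⟩ := hk
    obtain ⟨c, hcv, hcd, hcx⟩ := hvx.exists_child (by rintro rfl; omega)
    have hvc : P.Anc v c := anc_of_depth_eq hcv hcd
    have hcS : c ∈ S := hS x hx c hcx
    have hvS : v ∈ S := hS x hx v hvx
    have hcm : ¬ P.Tall S m c := fun ⟨y, hy, hcy, hyd⟩ =>
      hm ⟨y, hy, hvc.trans hcy, by omega⟩
    have h1 := ih c ⟨x, hx, hcx, by omega⟩ hcm
    have hvb : v ∉ P.below S c := fun h => by
      have := (mem_below.1 h).2.depth_le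
      omega
    have hsub : insert v (P.below S c) ⊆ P.below S v := by
      intro y hy
      rcases Finset.mem_insert.1 hy with rfl | hy
      · exact mem_below.2 ⟨hvS, Anc.refl _⟩
      · exact mem_below.2 ⟨(mem_below.1 hy).1, hvc.trans (mem_below.1 hy).2⟩
    have hcc : c ∈ P.childrenIn S v := mem_childrenIn.2 ⟨hcS, hcv, hcd⟩
    -- Besides `v` itself, the second unit comes from `v` being broken or from a second child `e`.
    by_cases h2 : (P.childrenIn S v).card = 1
    · have hvbr : v ∈ P.broken m S := mem_broken.2 ⟨hvS, h2, hm⟩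
      have h3 := Finset.card_le_card hsub
      rw [Finset.card_insert_of_notMem hvb] at h3
      have h4 : insert v (P.broken m S ∩ P.below S c) ⊆ P.broken m S ∩ P.below S v := by
        intro y hy
        rcases Finset.mem_insert.1 hy with rfl | hy
        · exact Finset.mem_inter.2 ⟨hvbr, mem_below.2 ⟨hvS, Anc.refl _⟩⟩
        · exact Finset.mem_inter.2 ⟨(Finset.mem_inter.1 hy).1,
            hsub (Finset.mem_insert_of_mem (Finset.mem_inter.1 hy).2)⟩
      have h5 := Finset.card_le_card h4
      rw [Finset.card_insert_of_notMem fun h => hvb (Finset.mem_inter.1 h).2] at h5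
      omega
    · have hpos : 0 < (P.childrenIn S v).card := Finset.card_pos.2 ⟨c, hcc⟩
      have hlt : 1 < (P.childrenIn S v).card := by omega
      obtain ⟨e, he, hec⟩ := Finset.exists_mem_ne hlt c
      obtain ⟨heS, hev, hed⟩ := mem_childrenIn.1 he
      have heb : e ∉ insert v (P.below S c) := by
        intro h
        rcases Finset.mem_insert.1 h with rfl | h
        · omega
        · exact hec ((mem_below.1 h).2.eq_of_depth_le (by omega)).symm
      have h3 : insert e (insert v (P.below S c)) ⊆ P.below S v :=
        Finset.insert_subset (mem_below.2 ⟨heS, anc_of_depth_eq hev hed⟩) hsub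
      have h4 := Finset.card_le_card h3
      rw [Finset.card_insert_of_notMem heb, Finset.card_insert_of_notMem hvb] at h4
      have h5 : (P.broken m S ∩ P.below S c).card ≤ (P.broken m S ∩ P.below S v).card :=
        Finset.card_le_card (Finset.inter_subset_inter_left
          ((Finset.subset_insert _ _).trans hsub))
      omega

/-- Nothing changes below a vertex that is not an ancestor of a removed vertex. -/
theorem mem_broken_of_subset {S S' : Finset V} (hsub : S' ⊆ S) {m : ℕ} {y : V}
    (hy : ∀ x ∈ S, x ∉ S' → ¬ P.Anc y x) (h : y ∈ P.broken m S') : y ∈ P.broken (m + 1) S := by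
  obtain ⟨h1, h2, h3⟩ := mem_broken.1 h
  have hch : P.childrenIn S y = P.childrenIn S' y := by
    ext c
    simp only [mem_childrenIn]
    constructor
    · rintro ⟨hc, hp, hd⟩
      exact ⟨by_contra fun hn => hy c hc hn (anc_of_depth_eq hp hd), hp, hd⟩
    · rintro ⟨hc, hp, hd⟩
      exact ⟨hsub hc, hp, hd⟩
  refine mem_broken.2 ⟨hsub h1, by rwa [hch], ?_⟩
  rintro ⟨x, hx, hyx, hd⟩
  exact h3 ⟨x, by_contra fun hn => hy x hx hn hyx, hyx, by omega⟩

-- The accounting of a removal: `B` contains all newly broken vertices, and the weight of `R` must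
-- pay for them besides `t`.
open Classical in
theorem weight_le_of_subset {S S' R B : Finset V} {m t : ℕ} (hS' : S' = S \ R) (hR : R ⊆ S)
    (hB : P.broken m S' ⊆ (P.broken (m + 1) S \ R) ∪ B)
    (ht : t + B.card ≤ R.card + (P.broken (m + 1) S ∩ R).card) :
    S'.card + (P.broken m S').card + t ≤ S.card + (P.broken (m + 1) S).card := by
  have h1 : S'.card + R.card = S.card := by
    rw [hS']
    exact Finset.card_sdiff_add_card_eq_card hR
  have h2 := (Finset.card_le_card hB).trans (Finset.card_union_le _ _)
  have h3 := Finset.card_sdiff_add_card_inter (P.broken (m + 1) S) R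
  omega

end ParentTree

/-! ### Cutting off a ball, and the greedy cover. -/

namespace ParentTree

variable {V : Type*} {P : ParentTree V}

/-- A vertex below which the height is exactly `r`. -/
theorem exists_tall_not_tall {S : Finset V} (hS : P.Closed S) {r : ℕ}
    (h : P.Tall S (r + 1) P.root) :
    ∃ v ∈ S, v ≠ P.root ∧ P.Tall S r v ∧ ¬ P.Tall S (r + 1) v := by
  obtain ⟨z, hz, -, hzd⟩ := h
  obtain ⟨x, hx, hmax⟩ := S.exists_max_image P.depth ⟨z, hz⟩
  have hxd := hmax z hz
  have hr : r ≤ P.depth x := by omega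
  have hd := P.depth_iterate r x
  -- As `x` is a deepest vertex, nothing lies more than `r` levels below its `r`-th ancestor.
  refine ⟨P.par^[r] x, hS x hx _ (anc_iterate hr), fun h => ?_,
    ⟨x, hx, anc_iterate hr, by omega⟩, ?_⟩
  · rw [h] at hd
    omega
  · rintro ⟨y, hy, -, hyd⟩
    have := hmax y hy
    omega

theorem near_of_not_tall {S : Finset V} {r : ℕ} {v x : V} (hm : ¬ P.Tall S (r + 1) v)
    (hx : x ∈ S) (hvx : P.Anc v x) : P.Near r v x := by
  refine ⟨v, Anc.refl v, hvx, ?_⟩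
  by_contra hd
  exact hm ⟨x, hx, hvx, by omega⟩

open Classical in
/-- The vertices on the path between `a` and its ancestor at depth `i`. -/
theorem card_le_of_anc {B : Finset V} {a : V} {i j : ℕ} (h : ∀ y ∈ B, P.Anc y a)
    (hi : ∀ y ∈ B, i ≤ P.depth y) (hj : ∀ y ∈ B, P.depth y < j) : B.card ≤ j - i := by
  rw [← Nat.card_Ico]
  refine Finset.card_le_card_of_injOn P.depth
    (fun y hy => Finset.mem_coe.2 (Finset.mem_Ico.2 ⟨hi y hy, hj y hy⟩)) ?_
  intro y hy z hz hd
  exact (h y hy).eq_of_depth_eq (h z hz) hd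

open Classical in
theorem card_path_le {R : Finset V} {a p : V} (hap : P.Anc a p)
    (hR : ∀ x, P.Anc a x → P.Anc x p → x ≠ a → x ∈ R) :
    P.depth p - P.depth a ≤ (R.filter fun x => P.Anc x p).card := by
  rw [← Finset.card_range (P.depth p - P.depth a)]
  have hle := hap.depth_le
  refine Finset.card_le_card_of_injOn (fun k => P.par^[k] p) ?_ ?_
  · intro k hk
    have hk := Finset.mem_range.1 hk
    have hd := P.depth_iterate k p
    have hanc : P.Anc (P.par^[k] p) p := anc_iterate (by omega)
    refine Finset.mem_coe.2 (Finset.mem_filter.2 ⟨hR (P.par^[k] p) ?_ hanc ?_, hanc⟩)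
    · exact hap.linear hanc (by omega)
    · intro h
      replace h : P.par^[k] p = a := h
      rw [h] at hd
      omega
  · intro k hk l hl h
    have hk := Finset.mem_range.1 hk
    have hl := Finset.mem_range.1 hl
    have h1 := P.depth_iterate k p
    have h2 := P.depth_iterate l p
    simp only at h
    rw [h] at h1
    omega

open Classical in
/-- Counting each broken vertex twice, a ball of radius `r` around a vertex of height `r` disposes
of `2 * r + 1` vertices. -/
theorem exists_remove {S : Finset V} (hS : P.Closed S) (hroot : P.root ∈ S) {r : ℕ}
    (htall : P.Tall S (r + 1) P.root) :
    ∃ v, ∃ S' ⊆ S, P.Closed S' ∧ P.root ∈ S' ∧ (∀ x ∈ S, x ∉ S' → P.Near r v x) ∧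
      S'.card + (P.broken r S').card + (2 * r + 1) ≤ S.card + (P.broken (r + 1) S).card := by
  obtain ⟨v, hvS, hvr, hv, hv'⟩ := exists_tall_not_tall hS htall
  have hcount := two_mul_add_one_le_card_below hS r v hv hv'
  have hvd : 0 < P.depth v := Nat.pos_of_ne_zero fun h => hvr (P.eq_root v h)
  set p := P.par v with hp
  have hpd : P.depth v = P.depth p + 1 := by
    rw [hp, P.depth_par]
    omega
  have hpv : P.Anc p v := anc_of_depth_eq rfl hpd
  refine ⟨v, ?_⟩
  by_cases hcase : ∃ x ∈ S, ¬ P.Anc v x ∧ P.Anc p x ∧ ¬ P.Near r v x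
  · obtain ⟨x, hx, hvx, hpx, hnear⟩ := hcase
    have hxd : r + 2 * P.depth p < P.depth v + P.depth x := by
      by_contra hd
      exact hnear ⟨p, hpv, hpx, by omega⟩
    -- The far vertex `x` remains and lies at least `r` levels below `p`, so `p` and its ancestors
    -- are too tall to be broken.
    refine ⟨S \ P.below S v, Finset.sdiff_subset, ?_, ?_, ?_, ?_⟩
    · intro y hy z hzy
      have hy := Finset.mem_sdiff.1 hy
      exact Finset.mem_sdiff.2 ⟨hS y hy.1 z hzy, fun h =>
        hy.2 (mem_below.2 ⟨hy.1, (mem_below.1 h).2.trans hzy⟩)⟩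
    · exact Finset.mem_sdiff.2 ⟨hroot, fun h =>
        hvr ((mem_below.1 h).2.eq_of_depth_le (by rw [P.depth_root]; omega))⟩
    · intro y hy hy'
      refine near_of_not_tall hv' hy ?_
      by_contra hn
      exact hy' (Finset.mem_sdiff.2 ⟨hy, fun h => hn (mem_below.1 h).2⟩)
    · refine weight_le_of_subset (R := P.below S v) (B := ∅) rfl (Finset.filter_subset _ _) ?_
        (by simpa using hcount)
      intro y hy
      rw [Finset.union_empty]
      obtain ⟨hyS, -, hyt⟩ := mem_broken.1 hy
      have hyS := Finset.mem_sdiff.1 hyS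
      refine Finset.mem_sdiff.2 ⟨mem_broken_of_subset Finset.sdiff_subset ?_ hy, hyS.2⟩
      intro z hz hz' hyz
      have hvz : P.Anc v z := by
        by_contra hn
        exact hz' (Finset.mem_sdiff.2 ⟨hz, fun h => hn (mem_below.1 h).2⟩)
      have hvy : ¬ P.Anc v y := fun h => hyS.2 (mem_below.2 ⟨hyS.1, h⟩)
      have hyv : P.Anc y v := hyz.linear hvz (by
        by_contra hd
        exact hvy (hvz.linear hyz (by omega)))
      have hyp : P.Anc y p := hyv.anc_par (by rintro rfl; exact hvy (Anc.refl _))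
      have := hyp.depth_le
      exact hyt ⟨x, Finset.mem_sdiff.2 ⟨hx, fun h => hvx (mem_below.1 h).2⟩,
        hyp.trans hpx, by omega⟩
  · push Not at hcase
    -- Let `a` be the highest vertex on the path from `p` to the root below which all of `S` is in
    -- the ball. Everything strictly below `a` is removed; `a` stays as a leaf, hence is not broken.
    have hex : ∃ d, ∃ a, P.Anc a p ∧ P.depth a = d ∧
        ∀ x ∈ S, ¬ P.Anc v x → P.Anc a x → P.Near r v x := ⟨_, p, Anc.refl p, rfl, hcase⟩
    obtain ⟨a, hap, had, ha⟩ := Nat.find_spec hex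
    have hmin : ∀ b, P.Anc b p → P.depth b < P.depth a →
        ∃ x ∈ S, ¬ P.Anc v x ∧ P.Anc b x ∧ ¬ P.Near r v x := by
      intro b hb hd
      rw [had] at hd
      by_contra hn
      push Not at hn
      exact Nat.find_min hex hd ⟨b, hb, rfl, hn⟩
    have hav : P.Anc a v := hap.trans hpv
    have hapd := hap.depth_le
    have haS : a ∈ S := hS v hvS a hav
    set R := (P.below S a).erase a with hRdef
    have hR : ∀ x, x ∈ R ↔ x ∈ S ∧ P.Anc a x ∧ x ≠ a := by
      intro x
      rw [hRdef, Finset.mem_erase, mem_below]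
      tauto
    have hS' : ∀ x, x ∈ S \ R ↔ x ∈ S ∧ (P.Anc a x → x = a) := by
      intro x
      rw [Finset.mem_sdiff, hR]
      tauto
    have hRS : R ⊆ S := fun x hx => ((hR x).1 hx).1
    have hUR : P.below S v ⊆ R := by
      intro x hx
      obtain ⟨hx, hvx⟩ := mem_below.1 hx
      refine (hR x).2 ⟨hx, hav.trans hvx, ?_⟩
      rintro rfl
      have := hvx.depth_le
      omega
    have hcl : P.Closed (S \ R) := by
      intro y hy z hzy
      obtain ⟨hy, hya⟩ := (hS' y).1 hy
      refine (hS' z).2 ⟨hS y hy z hzy, fun haz => ?_⟩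
      have := hya (haz.trans hzy)
      subst this
      exact hzy.eq_of_depth_le haz.depth_le
    refine ⟨S \ R, Finset.sdiff_subset, hcl, ?_, ?_, ?_⟩
    · exact (hS' _).2 ⟨hroot, fun h =>
        (h.eq_of_depth_le (by rw [P.depth_root]; omega)).symm⟩
    · intro x hx hx'
      have hax : P.Anc a x := by
        by_contra hn
        exact hx' ((hS' x).2 ⟨hx, fun h => absurd h hn⟩)
      by_cases hvx : P.Anc v x
      · exact near_of_not_tall hv' hx hvx
      · exact ha x hx hvx hax
    · set B := (P.broken r (S \ R)).filter fun y => P.Anc y a with hB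
      have hBa : ∀ y ∈ B, P.Anc y a := fun y hy => (Finset.mem_filter.1 hy).2
      have hBbr : ∀ y ∈ B, y ∈ P.broken r (S \ R) := fun y hy => (Finset.mem_filter.1 hy).1
      have hBlt : ∀ y ∈ B, P.depth y < P.depth a := by
        intro y hy
        refine (hBa y hy).depth_lt ?_
        rintro rfl
        obtain ⟨c, hc⟩ := Finset.card_pos.1 (by
          rw [(mem_broken.1 (hBbr _ hy)).2.1]
          exact Nat.one_pos)
        obtain ⟨hc, hcp, hcd⟩ := mem_childrenIn.1 hc
        have := ((hS' c).1 hc).2 (anc_of_depth_eq hcp hcd)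
        rw [this] at hcd
        omega
      -- Let `y` be the highest vertex of `B`. By the choice of `a`, some remaining `x` below the
      -- parent `b` of `a` satisfies r + 2 depth b < depth v + depth x. As `y` has height less than
      -- r, depth x < depth y + r. Hence depth b - depth y < depth p - depth b.
      have hBcard : B.card ≤ P.depth p - P.depth a := by
        rcases B.eq_empty_or_nonempty with h0 | hne
        · simp [h0]
        obtain ⟨y, hy, hymin⟩ := B.exists_min_image P.depth hne
        have hya := hBa y hy
        have hylt := hBlt y hy
        have hyt : ∀ z ∈ S \ R, P.Anc y z → P.depth z < P.depth y + r := by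
          intro z hz hyz
          by_contra hd
          exact (mem_broken.1 (hBbr y hy)).2.2 ⟨z, hz, hyz, by omega⟩
        have hya' := hyt a ((hS' a).2 ⟨haS, fun _ => rfl⟩) hya
        have hyb : P.Anc y (P.par a) := hya.anc_par (by rintro rfl; omega)
        have hbd : P.depth (P.par a) = P.depth a - 1 := P.depth_par a
        set b := P.par a with hbdef
        have hba : P.Anc b a := anc_of_depth_eq rfl (by omega)
        obtain ⟨x, hx, hvx, hbx, hnear⟩ := hmin b (hba.trans hap) (by omega)
        have hax : ¬ P.Anc a x := fun h => hnear (ha x hx hvx h)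
        have hxd : r + 2 * P.depth b < P.depth v + P.depth x := by
          by_contra hd
          exact hnear ⟨b, hba.trans hav, hbx, by omega⟩
        have hxS' : x ∈ S \ R := (hS' x).2 ⟨hx, fun h => absurd h hax⟩
        have hxy := hyt x hxS' (hyb.trans hbx)
        -- If `b = x`, then `v` is more than `r` levels below `b`, while `B` has fewer than `r`
        -- vertices. Otherwise `b` keeps two children, `a` and `c`, and is not broken.
        by_cases hxb : b = x
        · have := card_le_of_anc hBa hymin hBlt
          rw [← hxb] at hxd
          omega
        · obtain ⟨c, hcb, hcd, hcx⟩ := hbx.exists_child hxb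
          have hbB : b ∉ B := by
            intro hb
            have h1 := (mem_broken.1 (hBbr b hb)).2.1
            have hac : a ≠ c := by
              rintro rfl
              exact hax hcx
            have h2 : ({a, c} : Finset V) ⊆ P.childrenIn (S \ R) b := by
              intro z hz
              rcases Finset.mem_insert.1 hz with rfl | hz
              · exact mem_childrenIn.2 ⟨(hS' _).2 ⟨haS, fun _ => rfl⟩, rfl, by omega⟩
              · rw [Finset.mem_singleton.1 hz]
                exact mem_childrenIn.2 ⟨hcl x hxS' c hcx, hcb, hcd⟩
            have h3 := Finset.card_le_card h2
            rw [Finset.card_pair hac] at h3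
            omega
          have hBlt' : ∀ z ∈ B, P.depth z < P.depth b := by
            intro z hz
            have h1 := hBlt z hz
            by_contra hd
            have : z = b := (hBa z hz).eq_of_depth_eq hba (by omega)
            exact hbB (this ▸ hz)
          have := card_le_of_anc hBa hymin hBlt'
          omega
      refine weight_le_of_subset (R := R) (B := B) rfl hRS ?_ ?_
      · intro y hy
        by_cases hya : P.Anc y a
        · exact Finset.mem_union_right _ (Finset.mem_filter.2 ⟨hy, hya⟩)
        · refine Finset.mem_union_left _ (Finset.mem_sdiff.2
            ⟨mem_broken_of_subset Finset.sdiff_subset ?_ hy, ?_⟩)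
          · intro z hz hz' hyz
            have haz : P.Anc a z := by
              by_contra hn
              exact hz' ((hS' z).2 ⟨hz, fun h => absurd h hn⟩)
            have hay : P.Anc a y := haz.linear hyz (by
              by_contra hd
              exact hya (hyz.linear haz (by omega)))
            have := ((hS' y).1 (mem_broken.1 hy).1).2 hay
            exact hya (this ▸ Anc.refl _)
          · exact (Finset.mem_sdiff.1 (mem_broken.1 hy).1).2
      -- The path from `p` up to, but excluding, `a` is disjoint from the subtree of `v`; it pays
      -- for `B`.
      · have hpath := card_path_le (R := R) hap (fun x hax hxp hxa =>
          (hR x).2 ⟨hS v hvS x (hxp.trans hpv), hax, hxa⟩)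
        have hdisj : Disjoint (P.below S v) (R.filter fun x => P.Anc x p) := by
          rw [Finset.disjoint_left]
          intro x hx hx'
          have h1 := (mem_below.1 hx).2.depth_le
          have h2 := (Finset.mem_filter.1 hx').2.depth_le
          omega
        have h1 := Finset.card_le_card
          (Finset.union_subset hUR (Finset.filter_subset (fun x => P.Anc x p) R))
        rw [Finset.card_union_of_disjoint hdisj] at h1
        have h2 : (P.broken (r + 1) S ∩ P.below S v).card ≤ (P.broken (r + 1) S ∩ R).card :=
          Finset.card_le_card (Finset.inter_subset_inter_left hUR)
        omega

/-- Covering an ancestor-closed set by balls of the radii `0, …, r`. -/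
theorem exists_cover (r : ℕ) (S : Finset V) (hS : P.Closed S) (hroot : P.root ∈ S)
    (hcard : S.card + (P.broken (r + 1) S).card ≤ (r + 1) ^ 2) :
    ∃ c : ℕ → V, ∀ x ∈ S, ∃ i ≤ r, P.Near i (c i) x := by
  induction r generalizing S with
  | zero =>
    refine ⟨fun _ => P.root, fun x hx => ⟨0, le_rfl, ?_⟩⟩
    have h1 : x = P.root := Finset.card_le_one.1 (by omega) x hx _ hroot
    exact ⟨P.root, Anc.refl _, anc_root x, by rw [h1, P.depth_root]⟩
  | succ r ih =>
    by_cases htall : P.Tall S (r + 2) P.root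
    · obtain ⟨v, S', hsub, hS', hroot', hnear, hw⟩ := exists_remove hS hroot htall
      -- (r + 2)² - (2(r + 1) + 1) = (r + 1)².
      obtain ⟨c, hc⟩ := ih S' hS' hroot' (by nlinarith)
      refine ⟨Function.update c (r + 1) v, fun x hx => ?_⟩
      by_cases hx' : x ∈ S'
      · obtain ⟨i, hi, h⟩ := hc x hx'
        exact ⟨i, by omega, by rwa [Function.update_of_ne (by omega)]⟩
      · exact ⟨r + 1, le_rfl, by simpa using hnear x hx hx'⟩
    · exact ⟨fun _ => P.root, fun x hx =>
        ⟨r + 1, le_rfl, near_of_not_tall htall hx (anc_root x)⟩⟩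

end ParentTree

/-! ### From graph trees to parent structures. -/

namespace GraphBurning

variable {V : Type*}

/-- The parent structure of a rooted tree. -/
noncomputable def parentTree (T : SimpleGraph V) (hT : T.IsTree) (root : V) : ParentTree V where
  root := root
  par v := open Classical in
    -- The default `v` is taken only at the root.
    if h : ∃ u, T.Adj u v ∧ T.dist root v = T.dist root u + 1 then h.choose else v
  depth v := T.dist root v
  depth_root := SimpleGraph.dist_self
  eq_root v h := (hT.connected.dist_eq_zero_iff.1 h).symm
  depth_par v := by
    split_ifs with h
    · have := h.choose_spec.2
      omega
    · by_contra hne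
      obtain ⟨w, hw⟩ := hT.connected.exists_walk_length_eq_dist v root
      cases w with
      | nil => exact hne (by simp)
      | cons hadj q =>
        refine h ⟨_, hadj.symm, ?_⟩
        rw [SimpleGraph.Walk.length_cons, SimpleGraph.dist_comm] at hw
        have h1 := SimpleGraph.dist_le q
        rw [SimpleGraph.dist_comm] at h1
        rcases hT.dist_eq_dist_add_one_of_adj root hadj with h2 | h2 <;> omega

variable {T : SimpleGraph V} {hT : T.IsTree} {root : V}

theorem depth_parentTree (v : V) : (parentTree T hT root).depth v = T.dist root v := rfl

theorem exists_adj_of_dist_ne_zero (hT : T.IsTree) {v : V} (h : T.dist root v ≠ 0) :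
    ∃ u, T.Adj u v ∧ T.dist root v = T.dist root u + 1 := by
  by_contra hn
  have h1 := (parentTree T hT root).depth_par v
  have h2 : (parentTree T hT root).par v = v := dif_neg hn
  rw [h2, depth_parentTree] at h1
  omega

theorem adj_par {v : V} (h : T.dist root v ≠ 0) : T.Adj ((parentTree T hT root).par v) v := by
  have h1 := exists_adj_of_dist_ne_zero hT h
  have h2 : (parentTree T hT root).par v = h1.choose := dif_pos h1
  rw [h2]
  exact h1.choose_spec.1

/-- In a tree the neighbor one step closer to the root is unique. -/
theorem eq_of_adj_of_dist (hT : T.IsTree) {u u' v : V} (h : T.Adj u v) (h' : T.Adj u' v)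
    (hd : T.dist root v = T.dist root u + 1) (hd' : T.dist root v = T.dist root u' + 1) :
    u = u' := by
  obtain ⟨p, hp⟩ := hT.connected.exists_walk_length_eq_dist root u
  obtain ⟨q, hq⟩ := hT.connected.exists_walk_length_eq_dist root u'
  have hp' : (p.concat h).IsPath :=
    SimpleGraph.Walk.isPath_of_length_eq_dist _ (by rw [SimpleGraph.Walk.length_concat]; omega)
  have hq' : (q.concat h').IsPath :=
    SimpleGraph.Walk.isPath_of_length_eq_dist _ (by rw [SimpleGraph.Walk.length_concat]; omega)
  have heq := congrArg SimpleGraph.Walk.penultimate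
    ((hT.existsUnique_path root v).unique hp' hq')
  simpa using heq

/-- Uniqueness of the neighbor closer to the root makes the chosen parent canonical; this transfers
fullness to `broken`. -/
theorem coe_childrenIn_univ [Fintype V] (v : V) :
    ((parentTree T hT root).childrenIn Finset.univ v : Set V) = children T root v := by
  ext c
  rw [Finset.mem_coe, ParentTree.mem_childrenIn]
  simp only [Finset.mem_univ, true_and, depth_parentTree, children, Set.mem_ofPred_eq]
  constructor
  · rintro ⟨rfl, hd⟩
    exact ⟨adj_par (by omega), hd⟩
  · rintro ⟨hadj, hd⟩
    refine ⟨?_, hd⟩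
    have h1 := adj_par (hT := hT) (root := root) (v := c) (by omega)
    refine eq_of_adj_of_dist hT h1 hadj ?_ hd
    have h2 := (parentTree T hT root).depth_par c
    simp only [depth_parentTree] at h2
    omega

theorem dist_le_of_anc {a x : V} (h : (parentTree T hT root).Anc a x) :
    T.dist a x ≤ T.dist root x - T.dist root a := by
  have key : ∀ k x, k ≤ T.dist root x → T.dist ((parentTree T hT root).par^[k] x) x ≤ k := by
    intro k
    induction k with
    | zero => simp
    | succ k ih =>
      intro x hx
      have hd := (parentTree T hT root).depth_par x
      simp only [depth_parentTree] at hd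
      have h1 := ih ((parentTree T hT root).par x) (by omega)
      have h2 := hT.connected.dist_triangle
        (u := (parentTree T hT root).par^[k] ((parentTree T hT root).par x))
        (v := (parentTree T hT root).par x) (w := x)
      have h3 := SimpleGraph.dist_eq_one_iff_adj.2
        (adj_par (hT := hT) (root := root) (v := x) (by omega))
      rw [Function.iterate_succ_apply]
      omega
  have h1 := key (T.dist root x - T.dist root a) x (Nat.sub_le _ _)
  unfold ParentTree.Anc at h
  simp only [depth_parentTree] at h
  rwa [h] at h1

theorem dist_le_of_near {r : ℕ} {v x : V} (h : (parentTree T hT root).Near r v x) :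
    T.dist v x ≤ r := by
  obtain ⟨a, hv, hx, hd⟩ := h
  have h1 := dist_le_of_anc hv
  have h2 := dist_le_of_anc hx
  have h3 := hT.connected.dist_triangle (u := v) (v := a) (w := x)
  have h4 := hv.depth_le
  have h5 := hx.depth_le
  rw [SimpleGraph.dist_comm] at h1
  simp only [depth_parentTree] at hd h4 h5
  omega

/-! ### From covers by balls to burning sequences. -/

theorem mem_burned_of_walk (G : SimpleGraph V) {k : ℕ} (x : Fin k → V) {u w : V}
    (p : G.Walk u w) {i : ℕ} (hu : u ∈ burned G x i) : w ∈ burned G x (i + p.length) := by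
  induction p generalizing i with
  | nil => exact hu
  | cons hadj q ih =>
    have := ih (i := i + 1) (Or.inl (Or.inr ⟨_, hu, hadj⟩))
    rwa [SimpleGraph.Walk.length_cons, add_comm q.length, ← add_assoc]

/-- Prescribed centers can be made to burn in time, unless the process terminates early. -/
theorem exists_sources (G : SimpleGraph V) (c : ℕ → V) (m : ℕ) :
    (∃ j ≤ m, ∃ x : Fin j → V, IsBurningSequence G x) ∨
      ∃ x : Fin m → V, (∀ i : Fin m, x i ∉ burned G x i) ∧ ∀ i < m, c i ∈ burned G x (i + 1) := by
  induction m with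
  | zero => exact Or.inr ⟨Fin.elim0, fun i => i.elim0, fun i hi => absurd hi (Nat.not_lt_zero i)⟩
  | succ m ih =>
    rcases ih with ⟨j, hj, hx⟩ | ⟨x, hx, hc⟩
    · exact Or.inl ⟨j, by omega, hx⟩
    by_cases hu : burned G x m = Set.univ
    · exact Or.inl ⟨m, by omega, x, hx, hu⟩
    -- If the prescribed center has already burned, any unburned vertex can be the source.
    obtain ⟨y, hy, hcy⟩ : ∃ y, y ∉ burned G x m ∧ (c m ∉ burned G x m → y = c m) := by
      by_cases hcm : c m ∈ burned G x m
      · obtain ⟨y, hy⟩ := (Set.ne_univ_iff_exists_notMem _).1 hu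
        exact ⟨y, hy, fun h => absurd hcm h⟩
      · exact ⟨c m, hcm, fun _ => rfl⟩
    refine Or.inr ⟨Fin.snoc x y, fun i => ?_, fun i hi => ?_⟩
    · rw [burned_snoc G x y i (Nat.lt_succ_iff.1 i.2)]
      refine Fin.lastCases ?_ (fun j => ?_) i
      · simpa using hy
      · simpa using hx j
    · rcases Nat.lt_succ_iff_lt_or_eq.1 hi with hi | rfl
      · rw [burned_snoc G x y _ hi]
        exact hc i hi
      · by_cases hcm : c i ∈ burned G x i
        · exact burned_subset_succ _ _ _ (by rwa [burned_snoc G x y i le_rfl])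
        · refine Or.inr ⟨Nat.lt_succ_self i, ?_⟩
          rw [← hcy hcm]
          exact (Fin.snoc_last (α := fun _ => V) y x).symm

/-- A connected graph that is covered by balls of the radii `0, …, r` can be burned in `r + 1`
rounds. -/
theorem burningNumber_le_of_cover (G : SimpleGraph V) (hG : G.Connected) {r : ℕ} (c : ℕ → V)
    (hc : ∀ x, ∃ i ≤ r, G.dist (c i) x ≤ i) : burningNumber G ≤ r + 1 := by
  -- The order is reversed: larger balls need more rounds to spread and start earlier.
  rcases exists_sources G (fun i => c (r - i)) (r + 1) with ⟨j, hj, hx⟩ | ⟨x, hx, hb⟩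
  · exact (Nat.sInf_le hx).trans hj
  · refine Nat.sInf_le ⟨x, hx, Set.eq_univ_of_forall fun w => ?_⟩
    obtain ⟨i, hi, hd⟩ := hc w
    obtain ⟨p, hp⟩ := hG.exists_walk_length_eq_dist (c i) w
    have h1 := hb (r - i) (by omega)
    rw [Nat.sub_sub_self hi] at h1
    exact monotone_nat_of_le_succ (burned_subset_succ G x) (by omega) (mem_burned_of_walk G x p h1)

end GraphBurning

theorem mainTheorem4 {V : Type*} [Fintype V] (T : SimpleGraph V)
    (hT : GraphBurning.IsFullBinaryTree T) :
    GraphBurning.burningNumber T ≤ ⌈Real.sqrt (Fintype.card V : ℝ)⌉₊ := by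
  obtain ⟨htree, root, hch⟩ := hT
  have hpos : 0 < Fintype.card V := Fintype.card_pos_iff.2 ⟨root⟩
  have hk : 0 < ⌈Real.sqrt (Fintype.card V : ℝ)⌉₊ :=
    Nat.ceil_pos.2 (Real.sqrt_pos.2 (by exact_mod_cast hpos))
  have hsq : Fintype.card V ≤ ⌈Real.sqrt (Fintype.card V : ℝ)⌉₊ ^ 2 := by
    have h := (Real.sqrt_le_left (by positivity)).1
      (Nat.le_ceil (Real.sqrt (Fintype.card V : ℝ)))
    exact_mod_cast h
  obtain ⟨r, hr⟩ := Nat.exists_eq_add_of_lt hk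
  rw [zero_add] at hr
  rw [hr] at hsq ⊢
  -- No vertex of a full binary tree has exactly one child, so the initial weight is n.
  have hbroken : (GraphBurning.parentTree T htree root).broken (r + 1) Finset.univ = ∅ := by
    refine Finset.eq_empty_of_forall_notMem fun v hv => ?_
    have h1 := (ParentTree.mem_broken.1 hv).2.1
    have h2 := hch v
    rw [← GraphBurning.coe_childrenIn_univ (hT := htree), Set.encard_coe_eq_coe_finsetCard,
      h1] at h2
    norm_num at h2
  obtain ⟨c, hc⟩ := ParentTree.exists_cover (P := GraphBurning.parentTree T htree root) r
    Finset.univ (fun _ _ v _ => Finset.mem_univ v) (Finset.mem_univ _)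
    (by rw [hbroken, Finset.card_empty, add_zero, Finset.card_univ]; exact hsq)
  refine GraphBurning.burningNumber_le_of_cover T htree.connected c fun x => ?_
  obtain ⟨i, hi, h⟩ := hc x (Finset.mem_univ x)
  exact ⟨i, hi, GraphBurning.dist_le_of_near h⟩
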